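/- Let $d\in\{1,2,3\}$, let $\Omega\subset\mathbb R^d$ be a bounded open set, $\mathcal O\subset\Omega$ open, $\eta>0$, $\nu_0\in\mathbb R$, $\mathbf v\in\mathbb R^d$, $y_s\in H^2(\Omega)\cap H^1_0(\Omega)$ and $\omega>0$. All functions are real-valued; $\langle\cdot,\cdot\rangle$ and $\|\cdot\|$ are the inner product and norm of $L^2(\Omega)$. Let $$a(z,\phi)=\eta\langle\nabla z,\nabla\phi\rangle+\langle y_s\,\mathbf v\cdot\nabla z,\phi\rangle+\langle (\mathbf v\cdot\nabla y_s)\, z,\phi\rangle+\nu_0\langle z,\phi\rangle .$$ Let $h_0>0$. For $0<h<h_0$ let $\mathcal T_h$ be a finite conforming simplicial triangulation of $\overline\Omega$ whose simplices have diameter at most $h$, and let $V_h\subset L^2(\Omega)$ be the space of all $v\in H^1_0(\Omega)\cap C(\overline\Omega)$ that are affine on each simplex of $\mathcal T_h$. Let $\pi_h:L^2(\Omega)\to V_h$ be the $L^2$-orthogonal projection, let $\mathcal A_h:V_h\to V_h$ be given by $\langle-\mathcal A_hz_h,\phi_h\rangle=a(z_h,\phi_h)$ for all $z_h,\phi_h\in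 V_h$, and put $\mathcal A_{\omega_h}=\mathcal A_h+\omega I_h$ and $\mathcal B_h=\pi_h\mathcal B$, where $\mathcal Bu=u\chi_{\mathcal O}$ for $u\in L^2(\Omega)$. Let $\mathcal P_h=\mathcal P_h^*\ge 0$ on $V_h$ be a solution of the discrete algebraic Riccati equation $$\mathcal A_{\omega_h}^*\mathcal P_h+\mathcal P_h\mathcal A_{\omega_h}-\mathcal P_h\mathcal B_h\mathcal B_h^*\mathcal P_h+I_h=0 .$$ Let $\omega_P>0$ and assume $$(\mathcal A_2)\qquad \langle(\mathcal A_{\omega_h}-\mathcal B_h\mathcal B_h^*\mathcal P_h)\phi_h,\phi_h\rangle\le-\omega_P\|\phi_h\|^2\quad\text{for all }\phi_h\in V_h,\ 0<h<h_0 .$$ Then there is a constant $C>0$, independent of $h$ and of $z_0$, such that for every $z_0\in L^2(\Omega)$ and every $0<h<h_0$ the semi-discrete nonlinear closed-loop system $$\tilde z_h'(t)=(\mathcal A_{\omega_h}-\mathcal B_h\mathcal B_h^*\mathcal P_h)\tilde z_h(t)-e^{-\omega t}\,\tilde z_h(t)\,\mathbf v\cdot\nabla\tilde z_h(t)\quad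 (t>0),\qquad \tilde z_h(0)=\pi_hz_0,$$ understood in $V_h$, that is, tested against all $\phi_h\in V_h$, has exactly one solution $\tilde z_h:[0,\infty)\to V_h$ (continuous on $[0,\infty)$ and differentiable on $(0,\infty)$), and this solution satisfies $$\|\tilde z_h(t)\|\le C\,e^{-\omega_Pt}\,\|z_0\|\qquad\text{for all }t\ge0 .$$ -/

import Mathlib

open MeasureTheory Set Filter Topology TopologicalSpace
open scoped InnerProductSpace

noncomputable section

namespace BurgersFEM

/-- Euclidean space `ℝ^d`. -/
abbrev Euc (d : ℕ) : Type := EuclideanSpace ℝ (Fin d)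

/-- The space `L²(Ω)` of real-valued functions, with its inner product `⟪f, g⟫ = ∫_Ω f g dx`. -/
abbrev L2 {d : ℕ} (Ω : Opens (Euc d)) : Type :=
  Lp ℝ 2 ((volume : Measure (Euc d)).restrict (Ω : Set (Euc d)))

/-- The space `L²(Ω; ℝ^d)` of vector fields. -/
abbrev L2vec {d : ℕ} (Ω : Opens (Euc d)) : Type :=
  Lp (Euc d) 2 ((volume : Measure (Euc d)).restrict (Ω : Set (Euc d)))

/-! ### Sobolev spaces -/

/-- Test functions: smooth functions with compact support contained in `Ω`. -/
structure IsTest {d : ℕ} (Ω : Opens (Euc d)) (φ : Euc d → ℝ) : Prop where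
  contDiff : ContDiff ℝ ((⊤ : ℕ∞) : WithTop ℕ∞) φ
  hasCompactSupport : HasCompactSupport φ
  tsupport_subset : tsupport φ ⊆ (Ω : Set (Euc d))

/-- `G ∈ L²(Ω; ℝ^d)` is the distributional gradient of `u ∈ L²(Ω)`:
`∫_Ω u ∇φ = - ∫_Ω φ G` for all test functions `φ`. -/
def HasWeakGrad {d : ℕ} (Ω : Opens (Euc d)) (u : L2 Ω) (G : L2vec Ω) : Prop :=
  ∀ φ : Euc d → ℝ, IsTest Ω φ →
    ∫ x in (Ω : Set (Euc d)), u x • gradient φ x = - ∫ x in (Ω : Set (Euc d)), φ x • G x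

open Classical in
/-- The distributional gradient of `u`, when it is in `L²(Ω; ℝ^d)` (and `0` otherwise). -/
def weakGrad {d : ℕ} {Ω : Opens (Euc d)} (u : L2 Ω) : L2vec Ω :=
  if h : ∃ G, HasWeakGrad Ω u G then h.choose else 0

lemma IsTest.add {d : ℕ} {Ω : Opens (Euc d)} {φ ψ : Euc d → ℝ}
    (hφ : IsTest Ω φ) (hψ : IsTest Ω ψ) : IsTest Ω (φ + ψ) :=
  ⟨hφ.1.add hψ.1, hφ.2.add hψ.2,
    (tsupport_add φ ψ).trans (union_subset hφ.3 hψ.3)⟩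

lemma IsTest.smul {d : ℕ} {Ω : Opens (Euc d)} {φ : Euc d → ℝ}
    (c : ℝ) (hφ : IsTest Ω φ) : IsTest Ω (c • φ) :=
  ⟨contDiff_const.smul hφ.1, hφ.2.mono fun x hx => by
      simp only [Function.mem_support, Pi.smul_apply, smul_eq_mul] at hx ⊢
      exact right_ne_zero_of_mul hx,
    (closure_mono fun x hx => by
      simp only [Function.mem_support, Pi.smul_apply, smul_eq_mul] at hx ⊢
      exact right_ne_zero_of_mul hx).trans hφ.3⟩

lemma gradient_add' {d : ℕ} {Ω : Opens (Euc d)} {φ ψ : Euc d → ℝ}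
    (hφ : IsTest Ω φ) (hψ : IsTest Ω ψ) (x : Euc d) :
    gradient (φ + ψ) x = gradient φ x + gradient ψ x := by
  have h1 := (hφ.1.differentiable (by simp)) x
  have h2 := (hψ.1.differentiable (by simp)) x
  simp only [gradient]
  rw [fderiv_add h1 h2, map_add]

lemma gradient_smul' {d : ℕ} {Ω : Opens (Euc d)} {φ : Euc d → ℝ}
    (hφ : IsTest Ω φ) (c : ℝ) (x : Euc d) :
    gradient (c • φ) x = c • gradient φ x := by
  have h1 := (hφ.1.differentiable (by simp)) x
  simp only [gradient]
  rw [fderiv_const_smul h1, map_smulₛₗ]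
  simp

lemma IsTest.memLp {d : ℕ} {Ω : Opens (Euc d)} {φ : Euc d → ℝ} (hφ : IsTest Ω φ) :
    MemLp φ 2 (volume.restrict (Ω : Set (Euc d))) :=
  (hφ.1.continuous.memLp_of_hasCompactSupport hφ.2).restrict _

lemma IsTest.memLp_gradient {d : ℕ} {Ω : Opens (Euc d)} {φ : Euc d → ℝ} (hφ : IsTest Ω φ) :
    MemLp (gradient φ) 2 (volume.restrict (Ω : Set (Euc d))) := by
  have hc : Continuous (gradient φ) :=
    (LinearIsometryEquiv.continuous _).comp (hφ.1.continuous_fderiv (by simp))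
  have hs : HasCompactSupport (gradient φ) :=
    (hφ.2.fderiv ℝ).comp_left (map_zero _)
  exact (hc.memLp_of_hasCompactSupport hs).restrict _

lemma integrable_smul_of_memLp {d : ℕ} {F : Type*} [NormedAddCommGroup F] [NormedSpace ℝ F]
    {μ : Measure (Euc d)} {f : Euc d → ℝ} {g : Euc d → F} (hf : MemLp f 2 μ) (hg : MemLp g 2 μ) :
    Integrable (fun x => f x • g x) μ :=
  memLp_one_iff_integrable.1 (hg.smul (r := 1) hf)

/-- The distributional gradient is unique. -/
lemma HasWeakGrad.unique {d : ℕ} {Ω : Opens (Euc d)} {u : L2 Ω} {G G' : L2vec Ω}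
    (h : HasWeakGrad Ω u G) (h' : HasWeakGrad Ω u G') : G = G' := by
  have hG : MemLp (fun x => G x - G' x) 2 (volume.restrict (Ω : Set (Euc d))) :=
    (Lp.memLp G).sub (Lp.memLp G')
  have hloc : LocallyIntegrableOn (fun x => G x - G' x) (Ω : Set (Euc d)) volume := by
    have h0 : LocallyIntegrable (fun x => G x - G' x) (volume.restrict (Ω : Set (Euc d))) :=
      hG.locallyIntegrable (by norm_num)
    exact locallyIntegrableOn_of_locallyIntegrable_restrict h0
  have key := Ω.isOpen.ae_eq_zero_of_integral_contDiff_smul_eq_zero hloc (by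
    intro φ h1 h2 h3
    have hφ : IsTest Ω φ := ⟨h1, h2, h3⟩
    have e : ∫ x, φ x • (G x - G' x) = ∫ x in (Ω : Set (Euc d)), φ x • (G x - G' x) := by
      refine (setIntegral_eq_integral_of_forall_compl_eq_zero fun x hx => ?_).symm
      rw [image_eq_zero_of_notMem_tsupport (fun h => hx (h3 h)), zero_smul]
    rw [e]
    simp only [smul_sub]
    rw [integral_sub (integrable_smul_of_memLp hφ.memLp (Lp.memLp G))
      (integrable_smul_of_memLp hφ.memLp (Lp.memLp G')), sub_eq_zero]
    exact neg_injective ((h φ hφ).symm.trans (h' φ hφ)))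
  apply Lp.ext
  filter_upwards [(ae_restrict_iff' Ω.isOpen.measurableSet).2 key] with x hx
  exact sub_eq_zero.1 hx

lemma HasWeakGrad.weakGrad_eq {d : ℕ} {Ω : Opens (Euc d)} {u : L2 Ω} {G : L2vec Ω}
    (h : HasWeakGrad Ω u G) : weakGrad u = G := by
  have h' : ∃ G, HasWeakGrad Ω u G := ⟨G, h⟩
  rw [weakGrad, dif_pos h']
  exact h'.choose_spec.unique h

lemma HasWeakGrad.add {d : ℕ} {Ω : Opens (Euc d)} {u w : L2 Ω} {G H : L2vec Ω}
    (h : HasWeakGrad Ω u G) (h' : HasWeakGrad Ω w H) : HasWeakGrad Ω (u + w) (G + H) := by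
  intro φ hφ
  have e1 : ∫ x in (Ω : Set (Euc d)), (u + w : L2 Ω) x • gradient φ x
      = ∫ x in (Ω : Set (Euc d)), (u x • gradient φ x + w x • gradient φ x) := by
    refine integral_congr_ae ?_
    filter_upwards [Lp.coeFn_add u w] with x hx
    rw [hx, Pi.add_apply, add_smul]
  have e2 : ∫ x in (Ω : Set (Euc d)), φ x • (G + H : L2vec Ω) x
      = ∫ x in (Ω : Set (Euc d)), (φ x • G x + φ x • H x) := by
    refine integral_congr_ae ?_
    filter_upwards [Lp.coeFn_add G H] with x hx
    rw [hx, Pi.add_apply, smul_add]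
  rw [e1, e2, integral_add (integrable_smul_of_memLp (Lp.memLp u) hφ.memLp_gradient)
    (integrable_smul_of_memLp (Lp.memLp w) hφ.memLp_gradient),
    integral_add (integrable_smul_of_memLp hφ.memLp (Lp.memLp G))
    (integrable_smul_of_memLp hφ.memLp (Lp.memLp H)), h φ hφ, h' φ hφ, neg_add]

lemma HasWeakGrad.smul {d : ℕ} {Ω : Opens (Euc d)} {u : L2 Ω} {G : L2vec Ω} (c : ℝ)
    (h : HasWeakGrad Ω u G) : HasWeakGrad Ω (c • u) (c • G) := by
  intro φ hφ
  have e1 : ∫ x in (Ω : Set (Euc d)), (c • u : L2 Ω) x • gradient φ x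
      = ∫ x in (Ω : Set (Euc d)), c • (u x • gradient φ x) := by
    refine integral_congr_ae ?_
    filter_upwards [Lp.coeFn_smul c u] with x hx
    rw [hx, Pi.smul_apply, smul_assoc]
  have e2 : ∫ x in (Ω : Set (Euc d)), φ x • (c • G : L2vec Ω) x
      = ∫ x in (Ω : Set (Euc d)), c • (φ x • G x) := by
    refine integral_congr_ae ?_
    filter_upwards [Lp.coeFn_smul c G] with x hx
    rw [hx, Pi.smul_apply, smul_comm]
  rw [e1, e2, integral_smul, integral_smul, h φ hφ, smul_neg]

lemma hasWeakGrad_zero {d : ℕ} (Ω : Opens (Euc d)) : HasWeakGrad Ω 0 0 := by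
  intro φ _
  have e1 : ∫ x in (Ω : Set (Euc d)), (0 : L2 Ω) x • gradient φ x = 0 := by
    refine integral_eq_zero_of_ae ?_
    filter_upwards [Lp.coeFn_zero ℝ 2 (volume.restrict (Ω : Set (Euc d)))] with x hx
    rw [hx]; simp
  have e2 : ∫ x in (Ω : Set (Euc d)), φ x • (0 : L2vec Ω) x = 0 := by
    refine integral_eq_zero_of_ae ?_
    filter_upwards [Lp.coeFn_zero (Euc d) 2 (volume.restrict (Ω : Set (Euc d)))] with x hx
    rw [hx]; simp
  rw [e1, e2, neg_zero]

/-- The Sobolev space `H¹(Ω)`, as a subspace of `L²(Ω)`. -/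
def H1 {d : ℕ} (Ω : Opens (Euc d)) : Submodule ℝ (L2 Ω) where
  carrier := {u | ∃ G, HasWeakGrad Ω u G}
  add_mem' := fun ⟨G, h⟩ ⟨H, h'⟩ => ⟨G + H, h.add h'⟩
  zero_mem' := ⟨0, hasWeakGrad_zero Ω⟩
  smul_mem' := fun c _ ⟨G, h⟩ => ⟨c • G, h.smul c⟩

lemma weakGrad_add {d : ℕ} {Ω : Opens (Euc d)} {u w : L2 Ω} (hu : u ∈ H1 Ω) (hw : w ∈ H1 Ω) :
    weakGrad (u + w) = weakGrad u + weakGrad w := by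
  obtain ⟨G, hG⟩ := hu
  obtain ⟨H, hH⟩ := hw
  rw [(hG.add hH).weakGrad_eq, hG.weakGrad_eq, hH.weakGrad_eq]

lemma weakGrad_smul {d : ℕ} {Ω : Opens (Euc d)} {u : L2 Ω} (c : ℝ) (hu : u ∈ H1 Ω) :
    weakGrad (c • u) = c • weakGrad u := by
  obtain ⟨G, hG⟩ := hu
  rw [(hG.smul c).weakGrad_eq, hG.weakGrad_eq]

lemma weakGrad_zero {d : ℕ} (Ω : Opens (Euc d)) : weakGrad (0 : L2 Ω) = 0 :=
  (hasWeakGrad_zero Ω).weakGrad_eq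

/-- The Sobolev space `H²(Ω)`: functions in `H¹(Ω)` all of whose first order distributional
derivatives are in `H¹(Ω)`. -/
def H2 {d : ℕ} (Ω : Opens (Euc d)) : Set (L2 Ω) :=
  {u | u ∈ H1 Ω ∧ ∀ i : Fin d, ∃ w ∈ H1 Ω,
    (w : Euc d → ℝ) =ᵐ[volume.restrict (Ω : Set (Euc d))] fun x => (weakGrad u x) i}

/-- The pairs `(φ, ∇φ)` in `L²(Ω) × L²(Ω; ℝ^d)`, for test functions `φ`. -/
def testPairs {d : ℕ} (Ω : Opens (Euc d)) : Submodule ℝ (L2 Ω × L2vec Ω) where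
  carrier := {p | ∃ φ, IsTest Ω φ ∧
    (p.1 : Euc d → ℝ) =ᵐ[volume.restrict (Ω : Set (Euc d))] φ ∧
    (p.2 : Euc d → Euc d) =ᵐ[volume.restrict (Ω : Set (Euc d))] gradient φ}
  add_mem' := by
    rintro p q ⟨φ, hφ, h1, h2⟩ ⟨ψ, hψ, h3, h4⟩
    refine ⟨φ + ψ, hφ.add hψ, ?_, ?_⟩
    · filter_upwards [Lp.coeFn_add p.1 q.1, h1, h3] with x e a b
      rw [Prod.fst_add, e, Pi.add_apply, Pi.add_apply, a, b]
    · filter_upwards [Lp.coeFn_add p.2 q.2, h2, h4] with x e a b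
      rw [Prod.snd_add, e, Pi.add_apply, a, b, gradient_add' hφ hψ]
  zero_mem' := by
    refine ⟨0, ⟨contDiff_const, HasCompactSupport.zero, by simp⟩, ?_, ?_⟩
    · exact Lp.coeFn_zero ℝ 2 _
    · filter_upwards [Lp.coeFn_zero (Euc d) 2 (volume.restrict (Ω : Set (Euc d)))] with x hx
      rw [Prod.snd_zero, hx]
      simp [gradient]
  smul_mem' := by
    rintro c p ⟨φ, hφ, h1, h2⟩
    refine ⟨c • φ, hφ.smul c, ?_, ?_⟩
    · filter_upwards [Lp.coeFn_smul c p.1, h1] with x e a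
      rw [Prod.smul_fst, e, Pi.smul_apply, Pi.smul_apply, a]
    · filter_upwards [Lp.coeFn_smul c p.2, h2] with x e a
      rw [Prod.smul_snd, e, Pi.smul_apply, a, gradient_smul' hφ]

/-- The Sobolev space `H¹₀(Ω)`: the closure of the test functions for the `H¹` norm. -/
def H10 {d : ℕ} (Ω : Opens (Euc d)) : Submodule ℝ (L2 Ω) where
  carrier := {u | u ∈ H1 Ω ∧ (u, weakGrad u) ∈ (testPairs Ω).topologicalClosure}
  add_mem' := by
    rintro u w ⟨hu, hu'⟩ ⟨hw, hw'⟩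
    refine ⟨add_mem hu hw, ?_⟩
    rw [weakGrad_add hu hw]
    exact add_mem hu' hw'
  zero_mem' := by
    refine ⟨zero_mem _, ?_⟩
    rw [weakGrad_zero]
    exact zero_mem _
  smul_mem' := by
    rintro c u ⟨hu, hu'⟩
    refine ⟨Submodule.smul_mem _ c hu, ?_⟩
    rw [weakGrad_smul c hu]
    exact Submodule.smul_mem _ c hu'

/-! ### Finite elements -/

/-- A (conforming, simplicial) triangulation of `closure Ω`. -/
structure Triangulation {d : ℕ} (Ω : Opens (Euc d)) where
  complex : Geometry.SimplicialComplex ℝ (Euc d)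
  finite : complex.faces.Finite
  space_eq : complex.space = closure (Ω : Set (Euc d))

/-- `f` is continuous on `closure Ω` and affine on each simplex of the triangulation. -/
def IsP1 {d : ℕ} {Ω : Opens (Euc d)} (T : Triangulation Ω) (f : Euc d → ℝ) : Prop :=
  ContinuousOn f (closure (Ω : Set (Euc d))) ∧
    ∀ s ∈ T.complex.faces, ∃ a : Euc d →ᵃ[ℝ] ℝ, ∀ x ∈ convexHull ℝ (s : Set (Euc d)), f x = a x

lemma IsP1.add {d : ℕ} {Ω : Opens (Euc d)} {T : Triangulation Ω} {f g : Euc d → ℝ}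
    (hf : IsP1 T f) (hg : IsP1 T g) : IsP1 T (f + g) := by
  refine ⟨hf.1.add hg.1, fun s hs => ?_⟩
  obtain ⟨a, ha⟩ := hf.2 s hs
  obtain ⟨b, hb⟩ := hg.2 s hs
  exact ⟨a + b, fun x hx => by simp [ha x hx, hb x hx]⟩

lemma IsP1.smul {d : ℕ} {Ω : Opens (Euc d)} {T : Triangulation Ω} {f : Euc d → ℝ} (c : ℝ)
    (hf : IsP1 T f) : IsP1 T (c • f) := by
  refine ⟨hf.1.const_smul c, fun s hs => ?_⟩
  obtain ⟨a, ha⟩ := hf.2 s hs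
  exact ⟨c • a, fun x hx => by simp [ha x hx]⟩

lemma isP1_zero {d : ℕ} {Ω : Opens (Euc d)} (T : Triangulation Ω) : IsP1 T 0 :=
  ⟨continuousOn_const, fun _ _ => ⟨0, fun _ _ => by simp⟩⟩

/-- The finite element space
`V_h = {v ∈ H¹₀(Ω) ∩ C(closure Ω) : v is affine on each simplex of the triangulation}`,
as a subspace of `L²(Ω)`. -/
def femSpace {d : ℕ} {Ω : Opens (Euc d)} (T : Triangulation Ω) : Submodule ℝ (L2 Ω) where
  carrier := {u | u ∈ H10 Ω ∧
    ∃ f, IsP1 T f ∧ (u : Euc d → ℝ) =ᵐ[volume.restrict (Ω : Set (Euc d))] f}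
  add_mem' := by
    rintro u w ⟨hu, f, hf, huf⟩ ⟨hw, g, hg, hwg⟩
    refine ⟨add_mem hu hw, f + g, hf.add hg, ?_⟩
    filter_upwards [Lp.coeFn_add u w, huf, hwg] with x e a b
    rw [e, Pi.add_apply, Pi.add_apply, a, b]
  zero_mem' := ⟨zero_mem _, 0, isP1_zero T, Lp.coeFn_zero ℝ 2 _⟩
  smul_mem' := by
    rintro c u ⟨hu, f, hf, huf⟩
    refine ⟨Submodule.smul_mem _ c hu, c • f, hf.smul c, ?_⟩
    filter_upwards [Lp.coeFn_smul c u, huf] with x e a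
    rw [e, Pi.smul_apply, Pi.smul_apply, a]

lemma mem_H1_of_mem_femSpace {d : ℕ} {Ω : Opens (Euc d)} {T : Triangulation Ω}
    (u : femSpace T) : (u : L2 Ω) ∈ H1 Ω := u.2.1.1

lemma IsP1.eqOn_zero {d : ℕ} {Ω : Opens (Euc d)} {T : Triangulation Ω} {f : Euc d → ℝ}
    (hf : IsP1 T f) (h0 : ∀ x ∈ T.complex.vertices, f x = 0) :
    ∀ x ∈ closure (Ω : Set (Euc d)), f x = 0 := by
  intro x hx
  rw [← T.space_eq, Geometry.SimplicialComplex.mem_space_iff] at hx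
  obtain ⟨s, hs, hxs⟩ := hx
  obtain ⟨a, ha⟩ := hf.2 s hs
  have h1 : a '' (s : Set (Euc d)) ⊆ {0} := by
    rintro _ ⟨y, hy, rfl⟩
    rw [mem_singleton_iff, ← ha y (subset_convexHull ℝ _ hy)]
    refine h0 y ?_
    rw [Geometry.SimplicialComplex.vertices_eq]
    exact mem_biUnion hs hy
  have h2 : a x ∈ convexHull ℝ (a '' (s : Set (Euc d))) := by
    rw [← AffineMap.image_convexHull]
    exact mem_image_of_mem a hxs
  have h3 := convexHull_mono h1 h2
  rw [convexHull_singleton, mem_singleton_iff] at h3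
  rw [ha x hxs, h3]

/-- The space `V_h` has finite dimension. -/
instance {d : ℕ} {Ω : Opens (Euc d)} (T : Triangulation Ω) :
    FiniteDimensional ℝ (femSpace T) := by
  have hfin : Finite T.complex.vertices := by
    refine Set.Finite.to_subtype ?_
    rw [Geometry.SimplicialComplex.vertices_eq]
    exact T.finite.biUnion fun s _ => s.finite_toSet
  choose r hr using fun u : femSpace T => u.2.2
  have huniq : ∀ (u : femSpace T) (g : Euc d → ℝ), IsP1 T g →
      ((u : L2 Ω) : Euc d → ℝ) =ᵐ[volume.restrict (Ω : Set (Euc d))] g →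
      ∀ x ∈ closure (Ω : Set (Euc d)), r u x = g x := by
    intro u g hg hug
    have h1 : r u =ᵐ[volume.restrict (Ω : Set (Euc d))] g := (hr u).2.symm.trans hug
    have h2 : EqOn (r u) g (Ω : Set (Euc d)) :=
      Measure.eqOn_open_of_ae_eq h1 Ω.isOpen ((hr u).1.1.mono subset_closure)
        (hg.1.mono subset_closure)
    exact h2.of_subset_closure (hr u).1.1 hg.1 subset_closure subset_rfl
  have hv : ∀ x ∈ T.complex.vertices, x ∈ closure (Ω : Set (Euc d)) := fun x hx => by
    rw [← T.space_eq]
    exact Geometry.SimplicialComplex.vertices_subset_space hx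
  let L : femSpace T →ₗ[ℝ] (T.complex.vertices → ℝ) :=
    { toFun := fun u x => r u x
      map_add' := by
        intro u w
        ext x
        refine huniq (u + w) (r u + r w) ((hr u).1.add (hr w).1) ?_ x (hv x x.2)
        filter_upwards [Lp.coeFn_add (u : L2 Ω) (w : L2 Ω), (hr u).2, (hr w).2] with y e a b
        rw [Submodule.coe_add, e, Pi.add_apply, Pi.add_apply, a, b]
      map_smul' := by
        intro c u
        ext x
        refine huniq (c • u) (c • r u) ((hr u).1.smul c) ?_ x (hv x x.2)
        filter_upwards [Lp.coeFn_smul c (u : L2 Ω), (hr u).2] with y e a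
        rw [Submodule.coe_smul, e, Pi.smul_apply, Pi.smul_apply, a] }
  refine FiniteDimensional.of_injective L ?_
  rw [← LinearMap.ker_eq_bot, LinearMap.ker_eq_bot']
  intro u hu
  have h0 := (hr u).1.eqOn_zero (fun x hx => congrFun hu ⟨x, hx⟩)
  apply Subtype.ext
  apply Lp.ext
  filter_upwards [(hr u).2, ae_restrict_mem Ω.isOpen.measurableSet,
    Lp.coeFn_zero ℝ 2 (volume.restrict (Ω : Set (Euc d)))] with x hx hxΩ hz
  rw [hx, h0 x (subset_closure hxΩ), Submodule.coe_zero, hz, Pi.zero_apply]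

/-- Elements of `V_h` are bounded. -/
lemma femSpace_bounded {d : ℕ} {Ω : Opens (Euc d)} {T : Triangulation Ω} (u : femSpace T) :
    ∃ C : ℝ, ∀ᵐ x ∂(volume.restrict (Ω : Set (Euc d))), ‖(u : L2 Ω) x‖ ≤ C := by
  obtain ⟨f, hf, huf⟩ := u.2.2
  have hK : IsCompact (closure (Ω : Set (Euc d))) := by
    rw [← T.space_eq, Geometry.SimplicialComplex.space]
    exact T.finite.isCompact_biUnion fun s _ => s.finite_toSet.isCompact_convexHull ℝ
  obtain ⟨C, hC⟩ := hK.exists_bound_of_continuousOn hf.1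
  refine ⟨C, ?_⟩
  filter_upwards [huf, ae_restrict_mem Ω.isOpen.measurableSet] with x hx hxΩ
  rw [hx]
  exact hC x (subset_closure hxΩ)

/-- The `L²`-orthogonal projection `π_h : L²(Ω) → V_h`. -/
def proj {d : ℕ} {Ω : Opens (Euc d)} (T : Triangulation Ω) : L2 Ω →L[ℝ] femSpace T :=
  (femSpace T).orthogonalProjectionOnto

/-! ### The linearized operator and its discretization -/

/-- `b(w, z, φ) = ∫_Ω w (v · ∇z) φ dx`. -/
def transport {d : ℕ} {Ω : Opens (Euc d)} (v : Euc d) (w z φ : L2 Ω) : ℝ :=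
  ∫ x in (Ω : Set (Euc d)), w x * ⟪v, weakGrad z x⟫_ℝ * φ x

/-- The form `a(z, φ) = η ⟨∇z, ∇φ⟩ + ⟨y_s v·∇z, φ⟩ + ⟨(v·∇y_s) z, φ⟩ + ν₀ ⟨z, φ⟩`. -/
def form {d : ℕ} {Ω : Opens (Euc d)} (η ν₀ : ℝ) (v : Euc d) (ys z φ : L2 Ω) : ℝ :=
  η * ⟪weakGrad z, weakGrad φ⟫_ℝ + transport v ys z φ + transport v z ys φ + ν₀ * ⟪z, φ⟫_ℝ

lemma integrable_transport {d : ℕ} {Ω : Opens (Euc d)} {T : Triangulation Ω} (v : Euc d)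
    (w z : L2 Ω) (φ : femSpace T) :
    Integrable (fun x => w x * ⟪v, weakGrad z x⟫_ℝ * (φ : L2 Ω) x)
      (volume.restrict (Ω : Set (Euc d))) := by
  obtain ⟨C, hC⟩ := femSpace_bounded φ
  refine Integrable.mul_bdd ?_ (Lp.aestronglyMeasurable (φ : L2 Ω)) hC
  exact integrable_smul_of_memLp (Lp.memLp w) ((Lp.memLp (weakGrad z)).const_inner v)

lemma transport_add_right {d : ℕ} {Ω : Opens (Euc d)} {T : Triangulation Ω} (v : Euc d)
    (w z : L2 Ω) (φ ψ : femSpace T) :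
    transport v w z ((φ + ψ : femSpace T) : L2 Ω) = transport v w z φ + transport v w z ψ := by
  simp only [transport]
  rw [← integral_add (integrable_transport v w z φ) (integrable_transport v w z ψ)]
  refine integral_congr_ae ?_
  filter_upwards [Lp.coeFn_add (φ : L2 Ω) (ψ : L2 Ω)] with x hx
  rw [Submodule.coe_add, hx, Pi.add_apply, mul_add]

lemma transport_smul_right {d : ℕ} {Ω : Opens (Euc d)} {T : Triangulation Ω} (v : Euc d)
    (w z : L2 Ω) (c : ℝ) (φ : femSpace T) :
    transport v w z ((c • φ : femSpace T) : L2 Ω) = c * transport v w z φ := by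
  simp only [transport]
  rw [← integral_const_mul]
  refine integral_congr_ae ?_
  filter_upwards [Lp.coeFn_smul c (φ : L2 Ω)] with x hx
  rw [Submodule.coe_smul, hx, Pi.smul_apply, smul_eq_mul]
  ring

lemma transport_add_mid {d : ℕ} {Ω : Opens (Euc d)} {T : Triangulation Ω} (v : Euc d)
    (w : L2 Ω) {z z' : L2 Ω} (hz : z ∈ H1 Ω) (hz' : z' ∈ H1 Ω) (φ : femSpace T) :
    transport v w (z + z') φ = transport v w z φ + transport v w z' φ := by
  simp only [transport]
  rw [← integral_add (integrable_transport v w z φ) (integrable_transport v w z' φ),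
    weakGrad_add hz hz']
  refine integral_congr_ae ?_
  filter_upwards [Lp.coeFn_add (weakGrad z) (weakGrad z')] with x hx
  rw [hx, Pi.add_apply, inner_add_right]
  ring

lemma transport_smul_mid {d : ℕ} {Ω : Opens (Euc d)} (v : Euc d)
    (w : L2 Ω) (c : ℝ) {z : L2 Ω} (hz : z ∈ H1 Ω) (φ : L2 Ω) :
    transport v w (c • z) φ = c * transport v w z φ := by
  simp only [transport]
  rw [← integral_const_mul, weakGrad_smul c hz]
  refine integral_congr_ae ?_
  filter_upwards [Lp.coeFn_smul c (weakGrad z)] with x hx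
  rw [hx, Pi.smul_apply, inner_smul_right]
  ring

lemma transport_add_left {d : ℕ} {Ω : Opens (Euc d)} {T : Triangulation Ω} (v : Euc d)
    (w w' z : L2 Ω) (φ : femSpace T) :
    transport v (w + w') z φ = transport v w z φ + transport v w' z φ := by
  simp only [transport]
  rw [← integral_add (integrable_transport v w z φ) (integrable_transport v w' z φ)]
  refine integral_congr_ae ?_
  filter_upwards [Lp.coeFn_add w w'] with x hx
  rw [hx, Pi.add_apply]
  ring

lemma transport_smul_left {d : ℕ} {Ω : Opens (Euc d)} (v : Euc d) (c : ℝ) (w z φ : L2 Ω) :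
    transport v (c • w) z φ = c * transport v w z φ := by
  simp only [transport]
  rw [← integral_const_mul]
  refine integral_congr_ae ?_
  filter_upwards [Lp.coeFn_smul c w] with x hx
  rw [hx, Pi.smul_apply, smul_eq_mul]
  ring

/-- The form `a` on `V_h × V_h`, as a bilinear map. -/
def formBilin {d : ℕ} {Ω : Opens (Euc d)} (T : Triangulation Ω) (η ν₀ : ℝ) (v : Euc d)
    (ys : L2 Ω) : femSpace T →ₗ[ℝ] femSpace T →ₗ[ℝ] ℝ :=
  LinearMap.mk₂ ℝ (fun z φ => form η ν₀ v ys (z : L2 Ω) (φ : L2 Ω))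
    (by
      intro z z' φ
      simp only [form, Submodule.coe_add]
      rw [weakGrad_add (mem_H1_of_mem_femSpace z) (mem_H1_of_mem_femSpace z'),
        transport_add_mid v ys (mem_H1_of_mem_femSpace z) (mem_H1_of_mem_femSpace z'),
        transport_add_left, inner_add_left, inner_add_left]
      ring)
    (by
      intro c z φ
      simp only [form, Submodule.coe_smul]
      rw [weakGrad_smul c (mem_H1_of_mem_femSpace z),
        transport_smul_mid v ys c (mem_H1_of_mem_femSpace z), transport_smul_left,
        real_inner_smul_left, real_inner_smul_left, smul_eq_mul]
      ring)
    (by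
      intro z φ ψ
      simp only [form]
      rw [transport_add_right, transport_add_right]
      simp only [Submodule.coe_add]
      rw [weakGrad_add (mem_H1_of_mem_femSpace φ) (mem_H1_of_mem_femSpace ψ),
        inner_add_right, inner_add_right]
      ring)
    (by
      intro c z φ
      simp only [form]
      rw [transport_smul_right, transport_smul_right]
      simp only [Submodule.coe_smul]
      rw [weakGrad_smul c (mem_H1_of_mem_femSpace φ),
        real_inner_smul_right, real_inner_smul_right, smul_eq_mul]
      ring)

/-- The discrete operator `A_h : V_h → V_h`, given by `⟨-A_h z, φ⟩ = a(z, φ)` for `z, φ ∈ V_h`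
(see `inner_neg_discreteOp`), through the Riesz representation on `V_h`. -/
def discreteOp {d : ℕ} {Ω : Opens (Euc d)} (T : Triangulation Ω) (η ν₀ : ℝ) (v : Euc d)
    (ys : L2 Ω) : femSpace T →L[ℝ] femSpace T :=
  LinearMap.toContinuousLinearMap
    { toFun := fun z => - (InnerProductSpace.toDual ℝ (femSpace T)).symm
        (LinearMap.toContinuousLinearMap (formBilin T η ν₀ v ys z))
      map_add' := by
        intro z z'
        simp only [map_add, neg_add]
      map_smul' := by
        intro c z
        simp only [map_smul, RingHom.id_apply, smul_neg] }

lemma inner_neg_discreteOp {d : ℕ} {Ω : Opens (Euc d)} (T : Triangulation Ω) (η ν₀ : ℝ)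
    (v : Euc d) (ys : L2 Ω) (z φ : femSpace T) :
    ⟪-(discreteOp T η ν₀ v ys z), φ⟫_ℝ = form η ν₀ v ys z φ := by
  simp only [discreteOp, LinearMap.coe_toContinuousLinearMap', LinearMap.coe_mk, AddHom.coe_mk,
    neg_neg]
  rw [InnerProductSpace.toDual_symm_apply]
  rfl

/-- `A_{ω,h} = A_h + ω I`. -/
def shiftedOp {d : ℕ} {Ω : Opens (Euc d)} (T : Triangulation Ω) (η ν₀ ω : ℝ) (v : Euc d)
    (ys : L2 Ω) : femSpace T →L[ℝ] femSpace T :=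
  discreteOp T η ν₀ v ys + ω • ContinuousLinearMap.id ℝ (femSpace T)

/-! ### The control operator -/

lemma memLp_indicator {d : ℕ} {Ω : Opens (Euc d)} (O : Opens (Euc d)) (u : L2 Ω) :
    MemLp ((O : Set (Euc d)).indicator u) 2 (volume.restrict (Ω : Set (Euc d))) :=
  (Lp.memLp u).indicator O.isOpen.measurableSet

/-- The control operator `B : L²(Ω) → L²(Ω)`, `B u = u χ_O`. -/
def controlOp {d : ℕ} (Ω O : Opens (Euc d)) : L2 Ω →L[ℝ] L2 Ω :=
  LinearMap.mkContinuous
    { toFun := fun u => (memLp_indicator O u).toLp _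
      map_add' := by
        intro u w
        apply Lp.ext
        filter_upwards [(memLp_indicator O (u + w)).coeFn_toLp, (memLp_indicator O u).coeFn_toLp,
          (memLp_indicator O w).coeFn_toLp, Lp.coeFn_add u w, Lp.coeFn_add
            ((memLp_indicator O u).toLp _) ((memLp_indicator O w).toLp _)] with x h1 h2 h3 h4 h5
        rw [h1, h5, Pi.add_apply, h2, h3]
        by_cases hx : x ∈ (O : Set (Euc d))
        · simp only [indicator_of_mem hx, h4, Pi.add_apply]
        · simp only [indicator_of_notMem hx, add_zero]
      map_smul' := by
        intro c u
        apply Lp.ext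
        filter_upwards [(memLp_indicator O (c • u)).coeFn_toLp, (memLp_indicator O u).coeFn_toLp,
          Lp.coeFn_smul c u, Lp.coeFn_smul c ((memLp_indicator O u).toLp _)] with x h1 h2 h3 h4
        rw [RingHom.id_apply, h1, h4, Pi.smul_apply, h2]
        by_cases hx : x ∈ (O : Set (Euc d))
        · simp only [indicator_of_mem hx, h3, Pi.smul_apply]
        · simp only [indicator_of_notMem hx, smul_zero] }
    1
    (by
      intro u
      rw [one_mul]
      refine Lp.norm_le_norm_of_ae_le ?_
      filter_upwards [(memLp_indicator O u).coeFn_toLp] with x hx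
      simp only [LinearMap.coe_mk, AddHom.coe_mk]
      rw [hx]
      exact norm_indicator_le_norm_self _ _)

/-- The discrete control operator `B_h = π_h B : L²(Ω) → V_h`. -/
def discreteControlOp {d : ℕ} {Ω : Opens (Euc d)} (T : Triangulation Ω) (O : Opens (Euc d)) :
    L2 Ω →L[ℝ] femSpace T :=
  (proj T).comp (controlOp Ω O)

/-! ### Riccati feedback and the nonlinear closed-loop system -/

/-- `P ∈ L(V)` solves the algebraic Riccati equation
`A* P + P A - P B B* P + I = 0`, `P = P* ≥ 0` on `V`. -/
structure IsRiccati {U V : Type*} [NormedAddCommGroup U] [InnerProductSpace ℝ U] [CompleteSpace U]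
    [NormedAddCommGroup V] [InnerProductSpace ℝ V] [CompleteSpace V]
    (A : V →L[ℝ] V) (B : U →L[ℝ] V) (P : V →L[ℝ] V) : Prop where
  isPositive : P.IsPositive
  eq : A.adjoint ∘L P + P ∘L A - P ∘L B ∘L B.adjoint ∘L P + ContinuousLinearMap.id ℝ V = 0

/-- The closed-loop operator `A_{ω,h} - B_h B_h* P_h` on `V_h`. -/
def closedLoopOp {d : ℕ} {Ω : Opens (Euc d)} (T : Triangulation Ω) (O : Opens (Euc d))
    (η ν₀ ω : ℝ) (v : Euc d) (ys : L2 Ω) (P : femSpace T →L[ℝ] femSpace T) :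
    femSpace T →L[ℝ] femSpace T :=
  shiftedOp T η ν₀ ω v ys - discreteControlOp T O ∘L (discreteControlOp T O).adjoint ∘L P

/-- `z : [0, ∞) → V_h` is a solution of the semi-discrete nonlinear closed-loop system
`z'(t) = (A_{ω,h} - B_h B_h* P_h) z(t) - e^{-ωt} z(t) v·∇z(t)` for `t > 0`, `z(0) = π_h z₀`,
the equation being tested against all `φ ∈ V_h`. -/
structure IsSolution {d : ℕ} {Ω : Opens (Euc d)} (T : Triangulation Ω) (O : Opens (Euc d))
    (η ν₀ ω : ℝ) (v : Euc d) (ys : L2 Ω) (P : femSpace T →L[ℝ] femSpace T) (z₀ : L2 Ω)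
    (z : ℝ → femSpace T) : Prop where
  continuousOn : ContinuousOn z (Ici 0)
  differentiableAt : ∀ t, 0 < t → DifferentiableAt ℝ z t
  equation : ∀ t, 0 < t → ∀ φ : femSpace T,
    ⟪deriv z t, φ⟫_ℝ =
      ⟪closedLoopOp T O η ν₀ ω v ys P (z t), φ⟫_ℝ
        - Real.exp (-ω * t) * transport v (z t : L2 Ω) (z t : L2 Ω) (φ : L2 Ω)
  initial : z 0 = proj T z₀

end BurgersFEM

end

/-!
The decay estimate is an energy argument. Testing the equation with the solution itself, the
nonlinear term contributes `∫_Ω z² (v·∇z) = 0`, so the dissipativity of the linear closed-loop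
operator gives `d/dt ‖z‖² ≤ -2 ω_P ‖z‖²`, and hence `‖z(t)‖ ≤ e^{-ω_P t} ‖π_h z₀‖` with constant
`1`, uniformly in `h`.

The cancellation (`transport_self_eq_zero`) is first proved in the form `∫_Ω g(u) v·∇u = 0` for
`u ∈ H¹₀(Ω)` and Lipschitz `g` with `g 0 = 0`. For a test function the integrand is `v·∇(G ∘ u)`
with `G' = g`, whose integral vanishes, and the identity passes to the `H¹` closure because both
factors depend continuously in `L²` on `(u, ∇u)`. Elements of `V_h` are bounded, so the square can
be replaced by a truncated, Lipschitz square.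

Existence and uniqueness take place in the finite-dimensional space `V_h`, where the nonlinearity
is a quadratic map `N` with `⟪N x, x⟫ = 0`. Multiplying the vector field by a bump function makes it
bounded and globally Lipschitz, so that the Picard-Lindelöf theorem applies on every interval
`[0, n]` (`exists_isForwardSolution_of_lipschitzWith`). The multiplied field is still dissipative,
hence the norm of its solutions does not increase; they remain where the bump function is `1` and
solve the original system (`exists_isForwardSolution`, `eqOn_of_isForwardSolution`).
-/

namespace BurgersFEM

/-! ### Forward solutions of ordinary differential equations -/

/-- `z` solves `z' = f(t, z)` on `[0, ∞)`: it is continuous on `[0, ∞)` and satisfies the equation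
at all `t > 0`. -/
structure IsForwardSolution {E : Type*} [NormedAddCommGroup E] [NormedSpace ℝ E]
    (f : ℝ → E → E) (z : ℝ → E) : Prop where
  continuousOn : ContinuousOn z (Ici 0)
  hasDerivAt : ∀ t, 0 < t → HasDerivAt z (f t (z t)) t

/-- Grönwall's inequality for a function that need not be differentiable at the initial time. -/
lemma le_exp_mul_of_hasDerivAt_le {g g' : ℝ → ℝ} {c b : ℝ} (hg : ContinuousOn g (Icc 0 b))
    (hg' : ∀ t ∈ Ioo 0 b, HasDerivAt g (g' t) t) (hle : ∀ t ∈ Ioo 0 b, g' t ≤ c * g t)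
    {t : ℝ} (ht : t ∈ Icc 0 b) : g t ≤ Real.exp (c * t) * g 0 := by
  have hexp : ∀ s : ℝ, HasDerivAt (fun s => Real.exp (-c * s)) (Real.exp (-c * s) * -c) s := by
    intro s
    simpa using ((hasDerivAt_id s).const_mul (-c)).exp
  have hanti : AntitoneOn (fun s => Real.exp (-c * s) * g s) (Icc 0 b) := by
    refine antitoneOn_of_hasDerivWithinAt_nonpos (convex_Icc 0 b)
      (f' := fun s => Real.exp (-c * s) * -c * g s + Real.exp (-c * s) * g' s)
      (ContinuousOn.mul (by fun_prop) hg) (fun s hs => ?_) (fun s hs => ?_)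
    · rw [interior_Icc] at hs
      exact ((hexp s).mul (hg' s hs)).hasDerivWithinAt
    · rw [interior_Icc] at hs
      nlinarith [mul_le_mul_of_nonneg_left (hle s hs) (Real.exp_pos (-c * s)).le]
  have h := hanti (left_mem_Icc.2 (ht.1.trans ht.2)) ht ht.1
  simp only [mul_zero, Real.exp_zero, one_mul] at h
  calc g t = Real.exp (c * t) * (Real.exp (-c * t) * g t) := by
        rw [← mul_assoc, ← Real.exp_add]; simp
    _ ≤ Real.exp (c * t) * g 0 := mul_le_mul_of_nonneg_left h (Real.exp_pos _).le

section InnerProduct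

variable {E : Type*} [NormedAddCommGroup E] [InnerProductSpace ℝ E]

/-- Uniqueness for a globally Lipschitz field, when the equation is not assumed at the initial
time. -/
lemma eq_of_hasDerivAt_of_lipschitzWith {f : ℝ → E → E} {K : NNReal}
    (hf : ∀ t, 0 ≤ t → LipschitzWith K (f t)) {w z : ℝ → E} {b : ℝ}
    (hw : ContinuousOn w (Icc 0 b)) (hz : ContinuousOn z (Icc 0 b))
    (hw' : ∀ t ∈ Ioo 0 b, HasDerivAt w (f t (w t)) t)
    (hz' : ∀ t ∈ Ioo 0 b, HasDerivAt z (f t (z t)) t) (h0 : w 0 = z 0)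
    {t : ℝ} (ht : t ∈ Icc 0 b) : w t = z t := by
  have h := le_exp_mul_of_hasDerivAt_le (g := fun s => ‖w s - z s‖ ^ 2) (c := 2 * K)
    ((hw.sub hz).norm.pow 2) (fun s hs => ((hw' s hs).sub (hz' s hs)).norm_sq) (fun s hs => ?_) ht
  · simp only [h0, sub_self, norm_zero] at h
    have : ‖w t - z t‖ ^ 2 = 0 := le_antisymm (by simpa using h) (by positivity)
    exact sub_eq_zero.1 (norm_eq_zero.1 (pow_eq_zero_iff two_ne_zero |>.1 this))
  · have h1 := real_inner_le_norm (w s - z s) (f s (w s) - f s (z s))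
    have h2 := (hf s hs.1.le).norm_sub_le (w s) (z s)
    have h3 := mul_le_mul_of_nonneg_left h2 (norm_nonneg (w s - z s))
    simp only [Pi.sub_apply]
    nlinarith

/-- A bounded, globally Lipschitz field has forward solutions for all times. -/
lemma exists_isForwardSolution_of_lipschitzWith [CompleteSpace E] {f : ℝ → E → E} {K L : NNReal}
    (hf : ∀ t, 0 ≤ t → LipschitzWith K (f t)) (hcont : ∀ x, ContinuousOn (f · x) (Ici 0))
    (hbdd : ∀ t, 0 ≤ t → ∀ x, ‖f t x‖ ≤ L) (x₀ : E) :
    ∃ z, IsForwardSolution f z ∧ z 0 = x₀ := by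
  have hloc : ∀ n : ℕ, ∃ α : ℝ → E, α 0 = x₀ ∧
      ∀ t ∈ Icc (0 : ℝ) n, HasDerivWithinAt α (f t (α t)) (Icc 0 n) t := by
    intro n
    have hPL : IsPicardLindelof f (tmin := 0) (tmax := n) ⟨0, left_mem_Icc.2 n.cast_nonneg⟩ x₀
        (L * n) 0 L K :=
      { lipschitzOnWith := fun t ht => (hf t ht.1).lipschitzOnWith
        continuousOn := fun x _ => (hcont x).mono Icc_subset_Ici_self
        norm_le := fun t ht x _ => hbdd t ht.1 x
        mul_max_le := by simp }
    exact hPL.exists_eq_forall_mem_Icc_hasDerivWithinAt₀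
  choose α hα0 hα using hloc
  have hαc : ∀ n, ContinuousOn (α n) (Icc 0 n) := fun n t ht => (hα n t ht).continuousWithinAt
  have hαd : ∀ n : ℕ, ∀ t ∈ Ioo (0 : ℝ) n, HasDerivAt (α n) (f t (α n t)) t := fun n t ht =>
    (hα n t (Ioo_subset_Icc_self ht)).hasDerivAt (Icc_mem_nhds ht.1 ht.2)
  have hglue : ∀ (m n : ℕ) (t : ℝ), 0 ≤ t → t ≤ m → t ≤ n → α m t = α n t := by
    intro m n t h0 hm hn
    exact eq_of_hasDerivAt_of_lipschitzWith hf (b := t) ((hαc m).mono (Icc_subset_Icc_right hm))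
      ((hαc n).mono (Icc_subset_Icc_right hn))
      (fun s hs => hαd m s ⟨hs.1, hs.2.trans_le hm⟩) (fun s hs => hαd n s ⟨hs.1, hs.2.trans_le hn⟩)
      ((hα0 m).trans (hα0 n).symm) ⟨h0, le_rfl⟩
  have hz : ∀ n : ℕ, EqOn (fun t => α ⌈t⌉₊ t) (α n) (Icc 0 n) := fun n t ht =>
    hglue _ _ t ht.1 (Nat.le_ceil t) ht.2
  refine ⟨fun t => α ⌈t⌉₊ t, ⟨fun t ht => ?_, fun t ht => ?_⟩, by simp [hα0]⟩
  · obtain ⟨n, hn⟩ := exists_nat_gt t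
    have h1 := ((hαc n).congr (hz n)) t ⟨ht, hn.le⟩
    refine h1.mono_of_mem_nhdsWithin ?_
    rw [← Ici_inter_Iic]
    exact inter_mem_nhdsWithin _ (Iic_mem_nhds hn)
  · obtain ⟨n, hn⟩ := exists_nat_gt t
    have h1 : HasDerivAt (α n) (f t (α ⌈t⌉₊ t)) t := by
      rw [show α ⌈t⌉₊ t = α n t from hz n ⟨ht.le, hn.le⟩]
      exact hαd n t ⟨ht, hn⟩
    exact h1.congr_of_eventuallyEq ((hz n).eventuallyEq_of_mem (Icc_mem_nhds ht hn))

/-- A forward solution of `z' = f(t, z)` decays exponentially when `f` is dissipative. -/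
lemma IsForwardSolution.norm_le {f : ℝ → E → E} {c : ℝ}
    (hf : ∀ t, 0 < t → ∀ x, ⟪f t x, x⟫_ℝ ≤ -c * ‖x‖ ^ 2) {z : ℝ → E} (hz : IsForwardSolution f z)
    {t : ℝ} (ht : 0 ≤ t) : ‖z t‖ ≤ Real.exp (-c * t) * ‖z 0‖ := by
  have h := le_exp_mul_of_hasDerivAt_le (g := fun s => ‖z s‖ ^ 2) (c := 2 * -c) (b := t)
    ((hz.continuousOn.mono Icc_subset_Ici_self).norm.pow 2)
    (fun s hs => (hz.hasDerivAt s hs.1).norm_sq)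
    (fun s hs => by
      have := hf s hs.1 (z s)
      rw [real_inner_comm]
      nlinarith) ⟨ht, le_rfl⟩
  refine (pow_le_pow_iff_left₀ (norm_nonneg _) (by positivity) two_ne_zero).1 ?_
  rwa [mul_pow, ← Real.exp_nat_mul, Nat.cast_ofNat, ← mul_assoc]

lemma inner_sub_smul_le {A : E →L[ℝ] E} {N : E → E} {c : ℝ}
    (hA : ∀ x, ⟪A x, x⟫_ℝ ≤ -c * ‖x‖ ^ 2) (hN0 : ∀ x, ⟪N x, x⟫_ℝ = 0) (s : ℝ) (x : E) :
    ⟪A x - s • N x, x⟫_ℝ ≤ -c * ‖x‖ ^ 2 := by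
  rw [inner_sub_left, real_inner_smul_left, hN0, mul_zero, sub_zero]
  exact hA x

/-- Forward solutions that stay in the ball where a cutoff is `1` solve the truncated equation. -/
lemma IsForwardSolution.bump_smul {f : ℝ → E → E} {z : ℝ → E} (hz : IsForwardSolution f z)
    {χ : E → ℝ} (hχ : ∀ t, 0 ≤ t → χ (z t) = 1) :
    IsForwardSolution (fun t x => χ x • f t x) z :=
  ⟨hz.continuousOn, fun t ht => by
    simpa only [hχ t ht.le, one_smul] using hz.hasDerivAt t ht⟩

end InnerProduct

/-! ### Dissipative systems with an energy-preserving nonlinearity -/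

section Dissipative

variable {V : Type*} [NormedAddCommGroup V] [InnerProductSpace ℝ V] [FiniteDimensional ℝ V]

/-- The truncation `χ(x) (A x - s(t) N(x))` by a bump function is bounded and globally Lipschitz in
`x`, uniformly in `t ≥ 0`. -/
lemma exists_lipschitzWith_bump_smul (χ : ContDiffBump (0 : V)) (A : V →L[ℝ] V) {N : V → V}
    (hN : ContDiff ℝ 1 N) {s : ℝ → ℝ} (hs : ∀ t, 0 ≤ t → |s t| ≤ 1) :
    ∃ K L : NNReal, (∀ t, 0 ≤ t → LipschitzWith K fun x => χ x • (A x - s t • N x)) ∧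
      ∀ t, 0 ≤ t → ∀ x, ‖χ x • (A x - s t • N x)‖ ≤ L := by
  have hA1 : ContDiff ℝ 1 fun x => χ x • A x := χ.contDiff.smul A.contDiff
  have hN1 : ContDiff ℝ 1 fun x => χ x • N x := χ.contDiff.smul hN
  have hAc : HasCompactSupport fun x => χ x • A x := χ.hasCompactSupport.smul_right
  have hNc : HasCompactSupport fun x => χ x • N x := χ.hasCompactSupport.smul_right
  obtain ⟨KA, hKA⟩ := hA1.lipschitzWith_of_hasCompactSupport hAc one_ne_zero
  obtain ⟨KN, hKN⟩ := hN1.lipschitzWith_of_hasCompactSupport hNc one_ne_zero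
  obtain ⟨LA, hLA⟩ := hAc.exists_bound_of_continuous hA1.continuous
  obtain ⟨LN, hLN⟩ := hNc.exists_bound_of_continuous hN1.continuous
  have hsplit : ∀ t x, χ x • (A x - s t • N x) = χ x • A x - s t • (χ x • N x) := fun t x => by
    rw [smul_sub, smul_comm]
  have hsmul : ∀ t, 0 ≤ t → ∀ x : V, ‖s t • x‖ ≤ ‖x‖ := fun t ht x => by
    rw [norm_smul]
    exact mul_le_of_le_one_left (norm_nonneg x) (hs t ht)
  refine ⟨KA + KN, (LA + LN).toNNReal, fun t ht => ?_, fun t ht x => ?_⟩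
  · simp only [hsplit]
    refine hKA.sub (LipschitzWith.of_dist_le_mul fun x y => ?_)
    rw [dist_eq_norm, ← smul_sub]
    refine (hsmul t ht _).trans ?_
    rw [← dist_eq_norm]
    exact hKN.dist_le_mul x y
  · rw [hsplit]
    refine le_trans ?_ (Real.le_coe_toNNReal _)
    exact (norm_sub_le _ _).trans (add_le_add (hLA x) ((hsmul t ht _).trans (hLN x)))

/-- The initial value problem `z' = A z - s(t) N(z)`, with `A` dissipative and `⟪N x, x⟫ = 0`, has
a forward solution for all times. -/
lemma exists_isForwardSolution {A : V →L[ℝ] V} {N : V → V} {c : ℝ} {s : ℝ → ℝ} (hc : 0 ≤ c)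
    (hA : ∀ x, ⟪A x, x⟫_ℝ ≤ -c * ‖x‖ ^ 2) (hN : ContDiff ℝ 1 N) (hN0 : ∀ x, ⟪N x, x⟫_ℝ = 0)
    (hs : Continuous s) (hs1 : ∀ t, 0 ≤ t → |s t| ≤ 1) (x₀ : V) :
    ∃ z, IsForwardSolution (fun t x => A x - s t • N x) z ∧ z 0 = x₀ := by
  let χ : ContDiffBump (0 : V) := ⟨‖x₀‖ + 1, ‖x₀‖ + 2, by positivity, by linarith⟩
  obtain ⟨K, L, hK, hL⟩ := exists_lipschitzWith_bump_smul χ A hN hs1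
  obtain ⟨z, hz, hz0⟩ := exists_isForwardSolution_of_lipschitzWith hK
    (fun x => by fun_prop) hL x₀
  have hbound : ∀ t, 0 ≤ t → ‖z t‖ ≤ ‖x₀‖ := by
    intro t ht
    have h := hz.norm_le (c := 0) (fun t _ x => ?_) ht
    · simpa [hz0] using h
    · rw [real_inner_smul_left, neg_zero, zero_mul]
      refine mul_nonpos_of_nonneg_of_nonpos χ.nonneg ((inner_sub_smul_le hA hN0 _ _).trans ?_)
      nlinarith [sq_nonneg ‖x‖]
  refine ⟨z, ⟨hz.continuousOn, fun t ht => ?_⟩, hz0⟩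
  have h1 : χ (z t) = 1 := χ.one_of_mem_closedBall (by
    rw [mem_closedBall_zero_iff]
    exact (hbound t ht.le).trans (le_add_of_nonneg_right zero_le_one))
  simpa only [h1, one_smul] using hz.hasDerivAt t ht

lemma eqOn_of_isForwardSolution {A : V →L[ℝ] V} {N : V → V} {c : ℝ} {s : ℝ → ℝ} (hc : 0 ≤ c)
    (hA : ∀ x, ⟪A x, x⟫_ℝ ≤ -c * ‖x‖ ^ 2) (hN : ContDiff ℝ 1 N) (hN0 : ∀ x, ⟪N x, x⟫_ℝ = 0)
    (hs1 : ∀ t, 0 ≤ t → |s t| ≤ 1) {w z : ℝ → V}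
    (hw : IsForwardSolution (fun t x => A x - s t • N x) w)
    (hz : IsForwardSolution (fun t x => A x - s t • N x) z) (h0 : w 0 = z 0) :
    EqOn w z (Ici 0) := by
  -- Both solutions stay in the ball of radius `‖z 0‖`, where the cutoff is `1`.
  let χ : ContDiffBump (0 : V) := ⟨‖z 0‖ + 1, ‖z 0‖ + 2, by positivity, by linarith⟩
  obtain ⟨K, -, hK, -⟩ := exists_lipschitzWith_bump_smul χ A hN hs1
  have hχ : ∀ {y : ℝ → V}, IsForwardSolution (fun t x => A x - s t • N x) y → y 0 = z 0 →
      ∀ t, 0 ≤ t → χ (y t) = 1 := by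
    intro y hy hy0 t ht
    refine χ.one_of_mem_closedBall ?_
    rw [mem_closedBall_zero_iff]
    have h := hy.norm_le (fun t _ x => inner_sub_smul_le hA hN0 (s t) x) ht
    have h1 : Real.exp (-c * t) ≤ 1 := Real.exp_le_one_iff.2 (by nlinarith)
    rw [hy0] at h
    exact (h.trans (mul_le_of_le_one_left (norm_nonneg _) h1)).trans
      (le_add_of_nonneg_right zero_le_one)
  have hw' := hw.bump_smul (hχ hw h0)
  have hz' := hz.bump_smul (hχ hz rfl)
  intro t ht
  exact eq_of_hasDerivAt_of_lipschitzWith hK (b := t)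
    (hw'.continuousOn.mono Icc_subset_Ici_self) (hz'.continuousOn.mono Icc_subset_Ici_self)
    (fun r hr => hw'.hasDerivAt r hr.1) (fun r hr => hz'.hasDerivAt r hr.1) h0 ⟨ht, le_rfl⟩

end Dissipative

/-! ### Cancellation of the transport term -/

/-- The truncated square `s ↦ (max (-M) (min M s))²`. -/
noncomputable def truncSq (M s : ℝ) : ℝ := (max (-M) (min M s)) ^ 2

lemma lipschitzWith_truncSq {M : ℝ} (hM : 0 ≤ M) :
    LipschitzWith (2 * M).toNNReal (truncSq M) := by
  refine LipschitzWith.of_dist_le_mul fun x y => ?_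
  have hclamp : ∀ s, |max (-M) (min M s)| ≤ M := fun s =>
    abs_le.2 ⟨le_max_left _ _, max_le (by linarith) (min_le_left _ _)⟩
  have h1 : |max (-M) (min M x) - max (-M) (min M y)| ≤ |x - y| := by
    have h := ((LipschitzWith.id.const_min M).const_max (-M)).dist_le_mul x y
    simpa [Real.dist_eq] using h
  rw [Real.dist_eq, Real.dist_eq, Real.coe_toNNReal _ (by positivity), truncSq, truncSq,
    sq_sub_sq, abs_mul]
  refine mul_le_mul ?_ h1 (abs_nonneg _) (by positivity)
  exact (abs_add_le _ _).trans (by linarith [hclamp x, hclamp y])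

lemma truncSq_zero {M : ℝ} (hM : 0 ≤ M) : truncSq M 0 = 0 := by
  simp [truncSq, hM]

lemma truncSq_of_abs_le {M s : ℝ} (hs : |s| ≤ M) : truncSq M s = s ^ 2 := by
  rw [truncSq, min_eq_right (abs_le.1 hs).2, max_eq_right (abs_le.1 hs).1]

/-- `∫_Ω g(φ) v·∇φ = 0` for test functions `φ`: the integrand is `v·∇(G ∘ φ)`, where `G` is the
primitive of `g` vanishing at `0`. -/
lemma IsTest.integral_comp_mul_inner_gradient {d : ℕ} {Ω : Opens (Euc d)} {φ : Euc d → ℝ}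
    (hφ : IsTest Ω φ) {g : ℝ → ℝ} (hg : Continuous g) (v : Euc d) :
    ∫ x in (Ω : Set (Euc d)), g (φ x) * ⟪v, gradient φ x⟫_ℝ = 0 := by
  let G : ℝ → ℝ := fun s => ∫ r in (0 : ℝ)..s, g r
  have hG : ∀ s, HasDerivAt G (g s) s := fun s =>
    intervalIntegral.integral_hasDerivAt_right (hg.intervalIntegrable _ _)
      (hg.stronglyMeasurableAtFilter _ _) hg.continuousAt
  have hφd : Differentiable ℝ φ := hφ.contDiff.differentiable (by simp)
  have hGφ : ∀ x, HasFDerivAt (G ∘ φ) (g (φ x) • fderiv ℝ φ x) x := fun x =>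
    (hG (φ x)).comp_hasFDerivAt x (hφd x).hasFDerivAt
  have hsupp : HasCompactSupport (G ∘ φ) := hφ.hasCompactSupport.comp_left (by simp [G])
  have hcont : Continuous (G ∘ φ) := continuous_iff_continuousAt.2 fun x => (hGφ x).continuousAt
  have hfd : (fun x => fderiv ℝ (G ∘ φ) x v) = fun x => g (φ x) * ⟪v, gradient φ x⟫_ℝ := by
    funext x
    rw [(hGφ x).fderiv, real_inner_comm, inner_gradient_left]
    rfl
  have hfdc : Continuous fun x => fderiv ℝ (G ∘ φ) x v := by
    simp only [(hGφ _).fderiv]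
    exact ((hg.comp hφ.contDiff.continuous).smul
      (hφ.contDiff.continuous_fderiv (by simp))).clm_apply continuous_const
  have hfds : HasCompactSupport fun x => fderiv ℝ (G ∘ φ) x v :=
    (hsupp.fderiv ℝ).comp_left (g := fun l : Euc d →L[ℝ] ℝ => l v) rfl
  have hzero : ∫ x, fderiv ℝ (G ∘ φ) x v = 0 := by
    have h := integral_mul_fderiv_eq_neg_fderiv_mul_of_integrable (μ := (volume : Measure (Euc d)))
      (f := fun _ : Euc d => (1 : ℝ)) (g := G ∘ φ) (v := v) (by simp)
      (by simpa using hfdc.integrable_of_hasCompactSupport hfds)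
      (by simpa only [one_mul] using hcont.integrable_of_hasCompactSupport hsupp)
      (fun x _ => differentiableAt_const _) (fun x _ => (hGφ x).differentiableAt)
    simpa using h
  rw [← hfd, setIntegral_eq_integral_of_forall_compl_eq_zero, hzero]
  intro x hx
  have hx' : x ∉ tsupport φ := fun h => hx (hφ.tsupport_subset h)
  rw [(hGφ x).fderiv, image_eq_zero_of_notMem_tsupport
    (fun h => hx' (tsupport_fderiv_subset ℝ h))]
  simp

/-- The identity `∫_Ω g(u) v·∇u = 0` on `H¹₀(Ω)`, for Lipschitz `g` with `g 0 = 0`: both factors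
depend continuously in `L²` on the pair `(u, ∇u)`. -/
lemma integral_comp_mul_inner_weakGrad {d : ℕ} {Ω : Opens (Euc d)} {u : L2 Ω} (hu : u ∈ H10 Ω)
    {g : ℝ → ℝ} {K : NNReal} (hg : LipschitzWith K g) (hg0 : g 0 = 0) (v : Euc d) :
    ∫ x in (Ω : Set (Euc d)), g (u x) * ⟪v, weakGrad u x⟫_ℝ = 0 := by
  let Φ : L2 Ω × L2vec Ω → ℝ := fun p =>
    ⟪(hg.compLp hg0 p.1 : L2 Ω), ((innerSL ℝ v).compLp p.2 : L2 Ω)⟫_ℝ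
  have hΦc : Continuous Φ :=
    ((hg.continuous_compLp hg0).comp continuous_fst).inner
      (((innerSL ℝ v).lipschitz.continuous_compLp (map_zero _)).comp continuous_snd)
  have hΦ : ∀ p, Φ p = ∫ x in (Ω : Set (Euc d)), g (p.1 x) * ⟪v, p.2 x⟫_ℝ := by
    intro p
    simp only [Φ]
    rw [L2.inner_def]
    refine integral_congr_ae ?_
    filter_upwards [hg.coeFn_compLp hg0 p.1, (innerSL ℝ v).coeFn_compLp p.2] with x h1 h2
    rw [h1, h2]
    simp [mul_comm]
  have hclosed : IsClosed {p | Φ p = 0} := isClosed_eq hΦc continuous_const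
  have htest : (testPairs Ω : Set (L2 Ω × L2vec Ω)) ⊆ {p | Φ p = 0} := by
    rintro p ⟨φ, hφ, h1, h2⟩
    rw [mem_ofPred_eq, hΦ, ← hφ.integral_comp_mul_inner_gradient hg.continuous v]
    refine integral_congr_ae ?_
    filter_upwards [h1, h2] with x h1 h2
    rw [h1, h2]
  have h := closure_minimal htest hclosed hu.2
  rwa [mem_ofPred_eq, hΦ] at h

/-- The transport term does not contribute to the energy balance: `∫_Ω z² v·∇z = 0`. -/
lemma transport_self_eq_zero {d : ℕ} {Ω : Opens (Euc d)} {T : Triangulation Ω} (v : Euc d)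
    (z : femSpace T) : transport v (z : L2 Ω) (z : L2 Ω) (z : L2 Ω) = 0 := by
  obtain ⟨C, hC⟩ := femSpace_bounded z
  have hM : 0 ≤ max C 0 := le_max_right _ _
  rw [transport, ← integral_comp_mul_inner_weakGrad z.2.1 (lipschitzWith_truncSq hM)
    (truncSq_zero hM) v]
  refine integral_congr_ae ?_
  filter_upwards [hC] with x hx
  rw [truncSq_of_abs_le (hx.trans (le_max_left _ _))]
  ring

/-! ### The closed-loop system as an ordinary differential equation on the finite element space -/

/-- The bilinear map `(w, z) ↦ b(w, z)` on `V_h` with `⟪b(w, z), φ⟫ = ∫_Ω w (v·∇z) φ` for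
`φ ∈ V_h`, through the Riesz representation on `V_h`. -/
noncomputable def discreteTransport {d : ℕ} {Ω : Opens (Euc d)} (T : Triangulation Ω)
    (v : Euc d) : femSpace T →ₗ[ℝ] femSpace T →ₗ[ℝ] femSpace T :=
  LinearMap.mk₂ ℝ
    (fun w z => (InnerProductSpace.toDual ℝ (femSpace T)).symm
      (LinearMap.toContinuousLinearMap
        { toFun := fun φ => transport v (w : L2 Ω) (z : L2 Ω) (φ : L2 Ω)
          map_add' := fun φ ψ => transport_add_right v _ _ φ ψ
          map_smul' := fun c φ => transport_smul_right v _ _ c φ }))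
    (fun w w' z => ext_inner_right ℝ fun φ => by
      simp only [inner_add_left, InnerProductSpace.toDual_symm_apply]
      exact transport_add_left v _ _ _ φ)
    (fun c w z => ext_inner_right ℝ fun φ => by
      simp only [real_inner_smul_left, InnerProductSpace.toDual_symm_apply]
      exact transport_smul_left v c _ _ _)
    (fun w z z' => ext_inner_right ℝ fun φ => by
      simp only [inner_add_left, InnerProductSpace.toDual_symm_apply]
      exact transport_add_mid v _ (mem_H1_of_mem_femSpace z) (mem_H1_of_mem_femSpace z') φ)
    (fun c w z => ext_inner_right ℝ fun φ => by
      simp only [real_inner_smul_left, InnerProductSpace.toDual_symm_apply]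
      exact transport_smul_mid v _ c (mem_H1_of_mem_femSpace z) _)

lemma inner_discreteTransport {d : ℕ} {Ω : Opens (Euc d)} (T : Triangulation Ω) (v : Euc d)
    (w z φ : femSpace T) :
    ⟪discreteTransport T v w z, φ⟫_ℝ = transport v (w : L2 Ω) (z : L2 Ω) (φ : L2 Ω) := by
  simp only [discreteTransport, LinearMap.mk₂_apply, InnerProductSpace.toDual_symm_apply]
  rfl

lemma contDiff_discreteTransport_self {d : ℕ} {Ω : Opens (Euc d)} (T : Triangulation Ω)
    (v : Euc d) : ContDiff ℝ 1 fun z : femSpace T => discreteTransport T v z z :=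
  (discreteTransport T v).toContinuousBilinearMap.isBoundedBilinearMap.contDiff.comp
    (contDiff_id.prodMk contDiff_id)

lemma isSolution_iff {d : ℕ} {Ω : Opens (Euc d)} (T : Triangulation Ω) (O : Opens (Euc d))
    (η ν₀ ω : ℝ) (v : Euc d) (ys : L2 Ω) (P : femSpace T →L[ℝ] femSpace T) (z₀ : L2 Ω)
    (z : ℝ → femSpace T) :
    IsSolution T O η ν₀ ω v ys P z₀ z ↔
      IsForwardSolution (fun t x => closedLoopOp T O η ν₀ ω v ys P x
        - Real.exp (-ω * t) • discreteTransport T v x x) z ∧ z 0 = proj T z₀ := by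
  have hfield : ∀ (t : ℝ) (x φ : femSpace T),
      ⟪closedLoopOp T O η ν₀ ω v ys P x - Real.exp (-ω * t) • discreteTransport T v x x, φ⟫_ℝ =
        ⟪closedLoopOp T O η ν₀ ω v ys P x, φ⟫_ℝ
          - Real.exp (-ω * t) * transport v (x : L2 Ω) (x : L2 Ω) (φ : L2 Ω) := fun t x φ => by
    rw [inner_sub_left, ← inner_discreteTransport]
    exact congrArg _ (real_inner_smul_left (discreteTransport T v x x) φ (Real.exp (-ω * t)))
  constructor
  · intro h
    refine ⟨⟨h.continuousOn, fun t ht => ?_⟩, h.initial⟩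
    convert (h.differentiableAt t ht).hasDerivAt using 1
    refine ext_inner_right ℝ fun φ => ?_
    rw [h.equation t ht φ, hfield]
  · rintro ⟨h, h0⟩
    refine ⟨h.continuousOn, fun t ht => (h.hasDerivAt t ht).differentiableAt, fun t ht φ => ?_, h0⟩
    rw [(h.hasDerivAt t ht).deriv, hfield]

end BurgersFEM

theorem mainTheorem12 {d : ℕ} (hd1 : 1 ≤ d) (hd3 : d ≤ 3)
    (Ω : TopologicalSpace.Opens (BurgersFEM.Euc d))
    (hΩ : Bornology.IsBounded (Ω : Set (BurgersFEM.Euc d)))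
    (O : TopologicalSpace.Opens (BurgersFEM.Euc d)) (hO : O ≤ Ω)
    (η : ℝ) (hη : 0 < η) (ν₀ : ℝ) (v : BurgersFEM.Euc d)
    (ys : BurgersFEM.L2 Ω) (hys2 : ys ∈ BurgersFEM.H2 Ω) (hys0 : ys ∈ BurgersFEM.H10 Ω)
    (ω : ℝ) (hω : 0 < ω)
    (h₀ : ℝ) (hh₀ : 0 < h₀) (ωP : ℝ) (hωP : 0 < ωP)
    (T : ℝ → BurgersFEM.Triangulation Ω)
    (hmesh : ∀ h ∈ Set.Ioo 0 h₀, ∀ s ∈ (T h).complex.faces,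
      Metric.diam (convexHull ℝ (s : Set (BurgersFEM.Euc d))) ≤ h)
    (P : (h : ℝ) → BurgersFEM.femSpace (T h) →L[ℝ] BurgersFEM.femSpace (T h))
    (hP : ∀ h ∈ Set.Ioo 0 h₀, BurgersFEM.IsRiccati
      (BurgersFEM.shiftedOp (T h) η ν₀ ω v ys) (BurgersFEM.discreteControlOp (T h) O) (P h))
    (hA2 : ∀ h ∈ Set.Ioo 0 h₀, ∀ φ : BurgersFEM.femSpace (T h),
      inner ℝ (BurgersFEM.closedLoopOp (T h) O η ν₀ ω v ys (P h) φ) φ ≤ -ωP * ‖φ‖ ^ 2) :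
    ∃ C : ℝ, 0 < C ∧ ∀ z₀ : BurgersFEM.L2 Ω, ∀ h ∈ Set.Ioo 0 h₀,
      ∃ z : ℝ → BurgersFEM.femSpace (T h),
        BurgersFEM.IsSolution (T h) O η ν₀ ω v ys (P h) z₀ z ∧
        (∀ w : ℝ → BurgersFEM.femSpace (T h),
          BurgersFEM.IsSolution (T h) O η ν₀ ω v ys (P h) z₀ w → Set.EqOn w z (Set.Ici 0)) ∧
        ∀ t : ℝ, 0 ≤ t → ‖z t‖ ≤ C * Real.exp (-ωP * t) * ‖z₀‖ := by
  refine ⟨1, one_pos, fun z₀ h hh => ?_⟩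
  have hN := BurgersFEM.contDiff_discreteTransport_self (T h) v
  have hN0 : ∀ z : BurgersFEM.femSpace (T h),
      inner ℝ (BurgersFEM.discreteTransport (T h) v z z) z = 0 := fun z => by
    rw [BurgersFEM.inner_discreteTransport, BurgersFEM.transport_self_eq_zero]
  have hs : ∀ t : ℝ, 0 ≤ t → |Real.exp (-ω * t)| ≤ 1 := fun t ht => by
    rw [Real.abs_exp, Real.exp_le_one_iff, neg_mul]
    exact neg_nonpos.2 (mul_nonneg hω.le ht)
  obtain ⟨z, hz, hz0⟩ := BurgersFEM.exists_isForwardSolution hωP.le (hA2 h hh) hN hN0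
    (s := fun t => Real.exp (-ω * t)) (by fun_prop) hs (BurgersFEM.proj (T h) z₀)
  refine ⟨z, (BurgersFEM.isSolution_iff ..).2 ⟨hz, hz0⟩, fun w hw => ?_, fun t ht => ?_⟩
  · obtain ⟨hw, hw0⟩ := (BurgersFEM.isSolution_iff ..).1 hw
    exact BurgersFEM.eqOn_of_isForwardSolution hωP.le (hA2 h hh) hN hN0 hs hw hz
      (hw0.trans hz0.symm)
  · have hdecay := hz.norm_le
      (fun t _ x => BurgersFEM.inner_sub_smul_le (hA2 h hh) hN0 (Real.exp (-ω * t)) x) ht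
    rw [hz0] at hdecay
    rw [one_mul]
    refine hdecay.trans (mul_le_mul_of_nonneg_left ?_ (Real.exp_pos _).le)
    exact Submodule.norm_orthogonalProjectionOnto_apply_le _ z₀
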